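/- A term in the variables $x_1,\dots,x_n$ is a conjunction of literals ($x_i$ or $\neg x_i$) in which no variable occurs more than once (the empty conjunction is true). A DNF $f$ is a disjunction of finitely many terms, computing a function $\{0,1\}^n\to\{0,1\}$ (the empty disjunction is $0$). Its size is the number of its terms, and it has width $w$ if each of its terms contains at most $w$ literals. A DNF $g$ $\varepsilon$-approximates $f$ if $g(x)=f(x)$ for at least a $1-\varepsilon$ fraction of the inputs $x\in\{0,1\}^n$. There is an absolute constant $C\in\mathbb N$ such that for all integers $n\ge 0$ and $w\ge 1$ and every real $\varepsilon>0$, every width-$w$ DNF $f$ in $n$ variables is $\varepsilon$-approximated by a width-$w$ DNF $g$ in the same $n$ variables of size at most $$\Bigl(2+\frac1w\log_2\frac1\varepsilon\Bigr)^{Cw}.$$ In particular, the strong form of the Gopalan–Meka–Reingold conjecture holds: for every $\varepsilon_0<1/2$ there is a constant $C'\in\mathbb N$, depending only on $\varepsilon_0$, such that for all integers $n\ge 0$, $w\ge 1$ and all $0<\varepsilon\le\varepsilon_0$, every width-$w$ DNF in $n$ variables is $\varepsilon$-approximated by a width-$w$ DNF in the same $n$ variables of size at most $\bigl(\log_2\frac1\varepsilon\bigr)^{C'w}$.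 -/

import Mathlib

namespace BoolFun

/-- A term (conjunction of literals) over the variables `x_i`, `i : Fin n`, in which no variable
occurs twice: `t i = none` if `x_i` does not occur, `t i = some true` if the literal `x_i` occurs,
`t i = some false` if the literal `¬ x_i` occurs. -/
abbrev Term (n : ℕ) : Type := Fin n → Option Bool

/-- The number of literals of a term. -/
def Term.width {n : ℕ} (t : Term n) : ℕ :=
  (Finset.univ.filter fun i => t i ≠ none).card

/-- Evaluation of a term: all of its literals are true at `x` (the empty term is always true). -/
def Term.eval {n : ℕ} (t : Term n) (x : Fin n → Bool) : Bool :=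
  decide (∀ i b, t i = some b → x i = b)

/-- A DNF in `n` variables, given by the list of its terms. -/
abbrev DNF (n : ℕ) : Type := List (Term n)

/-- The size of a DNF is its number of terms. -/
def DNF.size {n : ℕ} (f : DNF n) : ℕ := List.length f

/-- `f` is a width-`w` DNF: each of its terms contains at most `w` literals. -/
def DNF.HasWidth {n : ℕ} (f : DNF n) (w : ℕ) : Prop := ∀ t ∈ f, Term.width t ≤ w

/-- The boolean function computed by a DNF: the disjunction of its terms. -/
def DNF.eval {n : ℕ} (f : DNF n) (x : Fin n → Bool) : Bool :=
  decide (∃ t ∈ f, Term.eval t x = true)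

/-- `g` `ε`-approximates `f`: they agree on at least a `1 - ε` fraction of the inputs. -/
def Approximates {n : ℕ} (ε : ℝ) (g f : (Fin n → Bool) → Bool) : Prop :=
  1 - ε ≤ ((Finset.univ.filter fun x => g x = f x).card : ℝ) / 2 ^ n

end BoolFun

/-! Order the terms and let `p i` be the probability that term `i` is the first one satisfied. Take
a random restriction that fixes each variable with small probability `β`. Its subcube meets a set of
density `p` with probability at least `p ^ β` (`density_rpow_le_meetProb`, by induction on the
dimension). If the subcube meets the first-hit set of term `i`, fixing at most `w` further variables
makes `i` the first forced term. This costs a factor at most `2 / β` per literal, and the resulting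
events are disjoint, so the meeting probabilities sum to at most `K = (2 / β) ^ w`
(`sum_meetProb_firstHit_le`). Hence `∑ p i ^ β ≤ K`. Now discard the terms with `p i < δ ^ 2`. At
most `K * δ ^ (-2 * β)` remain, and since `β ≤ 1 / 2` the error is at most `δ * ∑ p i ^ β ≤ δ * K`.
Take `δ = ε / K` and `β = 1 / B`, where `B` is the base of the claimed bound. -/

namespace BoolFun

/-! ### Random restrictions -/

/-- The probability of the restriction `ρ` when every variable is fixed with probability `β`, to a
uniformly random bit, and is left free otherwise. -/
noncomputable def restrictionWeight (β : ℝ) {n : ℕ} (ρ : Term n) : ℝ :=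
  ∏ i, (ρ i).elim (1 - β) fun _ => β / 2

/-- The probability that the subcube given by a random restriction meets `S`. -/
noncomputable def meetProb (β : ℝ) {n : ℕ} (S : Finset (Fin n → Bool)) : ℝ :=
  ∑ ρ : Term n with ∃ x ∈ S, Term.eval ρ x = true, restrictionWeight β ρ

/-- The fraction of the cube that lies in `S`. -/
noncomputable def density {n : ℕ} (S : Finset (Fin n → Bool)) : ℝ := (S.card : ℝ) / 2 ^ n

/-- The section of `S` at the value `b` of the first coordinate. -/
def consSection {n : ℕ} (S : Finset (Fin (n + 1) → Bool)) (b : Bool) : Finset (Fin n → Bool) :=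
  Finset.univ.filter fun y => (Fin.cons b y : Fin (n + 1) → Bool) ∈ S

theorem Term.eval_iff {n : ℕ} (t : Term n) (x : Fin n → Bool) :
    Term.eval t x = true ↔ ∀ i b, t i = some b → x i = b := by
  simp [Term.eval]

theorem Term.eval_cons {n : ℕ} (o : Option Bool) (ρ : Term n) (b : Bool) (y : Fin n → Bool) :
    Term.eval (Fin.cons o ρ : Term (n + 1)) (Fin.cons b y : Fin (n + 1) → Bool) = true ↔
      (∀ c, o = some c → b = c) ∧ Term.eval ρ y = true := by
  simp [Term.eval_iff, Fin.forall_fin_succ]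

theorem restrictionWeight_nonneg {β : ℝ} (h0 : 0 ≤ β) (h1 : β ≤ 1) {n : ℕ} (ρ : Term n) :
    0 ≤ restrictionWeight β ρ := by
  refine Finset.prod_nonneg fun i _ => ?_
  cases ρ i <;> simp <;> linarith

theorem restrictionWeight_cons (β : ℝ) {n : ℕ} (o : Option Bool) (ρ : Term n) :
    restrictionWeight β (Fin.cons o ρ : Term (n + 1)) =
      o.elim (1 - β) (fun _ => β / 2) * restrictionWeight β ρ := by
  simp [restrictionWeight, Fin.prod_univ_succ]

theorem sum_restrictionWeight (β : ℝ) (n : ℕ) : ∑ ρ : Term n, restrictionWeight β ρ = 1 := by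
  have h : (Finset.univ : Finset (Term n)) = Fintype.piFinset fun _ => Finset.univ := by simp
  unfold restrictionWeight
  rw [h, ← Finset.prod_univ_sum (fun _ => Finset.univ)
    (fun _ (o : Option Bool) => o.elim (1 - β) fun _ => β / 2)]
  simp [Fintype.sum_option, mul_div_cancel₀]

theorem meetProb_nonneg {β : ℝ} (h0 : 0 ≤ β) (h1 : β ≤ 1) {n : ℕ} (S : Finset (Fin n → Bool)) :
    0 ≤ meetProb β S :=
  Finset.sum_nonneg fun ρ _ => restrictionWeight_nonneg h0 h1 ρ

theorem meetProb_mono {β : ℝ} (h0 : 0 ≤ β) (h1 : β ≤ 1) {n : ℕ} {S S' : Finset (Fin n → Bool)}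
    (h : S ⊆ S') : meetProb β S ≤ meetProb β S' := by
  refine Finset.sum_le_sum_of_subset_of_nonneg ?_ fun ρ _ _ => restrictionWeight_nonneg h0 h1 ρ
  intro ρ
  simp only [Finset.mem_filter, Finset.mem_univ, true_and]
  rintro ⟨x, hx, hρ⟩
  exact ⟨x, h hx, hρ⟩

theorem exists_mem_eval_cons {n : ℕ} (S : Finset (Fin (n + 1) → Bool)) (o : Option Bool)
    (ρ : Term n) :
    (∃ x ∈ S, Term.eval (Fin.cons o ρ : Term (n + 1)) x = true) ↔
      ∃ b, (∀ c, o = some c → b = c) ∧ ∃ y ∈ consSection S b, Term.eval ρ y = true := by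
  simp only [consSection, Finset.mem_filter, Finset.mem_univ, true_and]
  rw [Fin.exists_fin_succ_pi]
  simp only [Term.eval_cons]
  constructor
  · rintro ⟨b, y, h, h', h''⟩
    exact ⟨b, h', y, h, h''⟩
  · rintro ⟨b, h', y, h, h''⟩
    exact ⟨b, y, h, h', h''⟩

/-- Condition on the first coordinate: left free, either section may be met; fixed, only the chosen
one. -/
theorem meetProb_succ (β : ℝ) {n : ℕ} (S : Finset (Fin (n + 1) → Bool)) :
    meetProb β S = (1 - β) * meetProb β (consSection S true ∪ consSection S false) +
      β / 2 * (meetProb β (consSection S true) + meetProb β (consSection S false)) := by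
  unfold meetProb
  rw [Finset.sum_filter,
    ← Equiv.sum_comp (Fin.consEquiv fun _ : Fin (n + 1) => Option Bool),
    Fintype.sum_prod_type, Fintype.sum_option, Fintype.sum_bool]
  have hcons : ∀ (o : Option Bool) (ρ : Term n),
      Fin.consEquiv (fun _ => Option Bool) (o, ρ) = (Fin.cons o ρ : Term (n + 1)) :=
    fun _ _ => rfl
  simp only [hcons, exists_mem_eval_cons, restrictionWeight_cons, Finset.sum_filter,
    Finset.mem_union, Finset.mul_sum, mul_add, Bool.exists_bool, Option.elim]
  congr 1
  · refine Finset.sum_congr rfl fun ρ _ => ?_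
    rw [mul_ite, mul_zero]
    refine if_congr ?_ rfl rfl
    simp only [reduceCtorEq, false_imp_iff, implies_true, true_and, or_and_right, exists_or]
    exact or_comm
  · congr 1 <;> refine Finset.sum_congr rfl fun ρ _ => ?_ <;> rw [mul_ite, mul_zero] <;>
      refine if_congr ?_ rfl rfl <;> simp

/-! ### Small sets are met with large probability -/

theorem density_nonneg {n : ℕ} (S : Finset (Fin n → Bool)) : 0 ≤ density S := by
  unfold density; positivity

theorem density_le_one {n : ℕ} (S : Finset (Fin n → Bool)) : density S ≤ 1 := by
  unfold density
  rw [div_le_one (by positivity)]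
  have := Finset.card_le_univ S
  simp only [Fintype.card_pi, Fintype.card_bool, Finset.prod_const, Finset.card_univ,
    Fintype.card_fin] at this
  exact_mod_cast this

theorem density_succ {n : ℕ} (S : Finset (Fin (n + 1) → Bool)) :
    density S = (density (consSection S true) + density (consSection S false)) / 2 := by
  have h : S.card = (consSection S true).card + (consSection S false).card := by
    have h : S = Finset.univ.filter (· ∈ S) := by simp
    conv_lhs => rw [h]
    simp only [consSection, Finset.card_filter]
    rw [← Equiv.sum_comp (Fin.consEquiv fun _ : Fin (n + 1) => Bool),
      Fintype.sum_prod_type, Fintype.sum_bool]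
    rfl
  unfold density
  rw [h]
  push_cast
  field_simp
  ring

/-- The two-point inequality behind `density_rpow_le_meetProb`. -/
theorem average_rpow_le {β : ℝ} (h0 : 0 < β) (h1 : β ≤ 1) {a b : ℝ} (hb : 0 ≤ b) (hab : b ≤ a) :
    ((a + b) / 2) ^ β ≤ (1 - β) * a ^ β + β / 2 * (a ^ β + b ^ β) := by
  rcases hb.eq_or_lt with rfl | hb
  · have h2 : ((1 : ℝ) / 2) ^ β ≤ 1 + β * (-1 / 2) := by
      have := rpow_one_add_le_one_add_mul_self (s := -1 / 2) (by norm_num) h0.le h1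
      norm_num at this ⊢
      exact this
    have ha : 0 ≤ a ^ β := Real.rpow_nonneg hab _
    rw [add_zero, Real.zero_rpow h0.ne', div_eq_mul_one_div, Real.mul_rpow hab (by norm_num)]
    nlinarith
  · have ha : 0 < a := hb.trans_le hab
    obtain ⟨c, rfl⟩ : ∃ c, b = a * c := ⟨b / a, by field_simp⟩
    have hc : 0 < c := pos_of_mul_pos_right hb ha.le
    have hc1 : c ≤ 1 := by nlinarith
    -- After scaling by `a`, Bernoulli's inequality bounds the left side; `c ≤ c ^ β` then closes
    -- the gap.
    have h2 : ((1 + c) / 2) ^ β ≤ 1 + β * ((c - 1) / 2) := by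
      have := rpow_one_add_le_one_add_mul_self (s := (c - 1) / 2) (by linarith) h0.le h1
      rwa [show 1 + (c - 1) / 2 = (1 + c) / 2 by ring] at this
    have h3 : c ≤ c ^ β := by
      simpa using Real.rpow_le_rpow_of_exponent_ge hc hc1 h1
    have ha' : 0 ≤ a ^ β := Real.rpow_nonneg ha.le _
    rw [show (a + a * c) / 2 = a * ((1 + c) / 2) by ring, Real.mul_rpow ha.le (by linarith),
      Real.mul_rpow ha.le hc.le]
    have h4 : ((1 + c) / 2) ^ β ≤ (1 - β) + β / 2 * (1 + c ^ β) := by nlinarith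
    nlinarith [mul_le_mul_of_nonneg_left h4 ha']

/-- A random subcube that fixes few variables meets even a small set with large probability. -/
theorem density_rpow_le_meetProb {β : ℝ} (h0 : 0 < β) (h1 : β ≤ 1) :
    ∀ {n : ℕ} (S : Finset (Fin n → Bool)), density S ^ β ≤ meetProb β S
  | 0, S => by
    rcases S.eq_empty_or_nonempty with rfl | ⟨x, hx⟩
    · simp [density, meetProb, h0.ne']
    · refine (Real.rpow_le_one (density_nonneg S) (density_le_one S) h0.le).trans ?_
      rw [meetProb, Finset.filter_true_of_mem, sum_restrictionWeight]
      exact fun ρ _ => ⟨x, hx, (Term.eval_iff _ _).2 fun i => i.elim0⟩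
  | n + 1, S => by
    have key : ∀ A B : Finset (Fin n → Bool), density B ≤ density A →
        ((density A + density B) / 2) ^ β ≤
          (1 - β) * meetProb β (A ∪ B) + β / 2 * (meetProb β A + meetProb β B) := by
      intro A B h
      refine (average_rpow_le h0 h1 (density_nonneg B) h).trans ?_
      have hA := density_rpow_le_meetProb h0 h1 A
      have hB := density_rpow_le_meetProb h0 h1 B
      -- Of the union, only the denser section is used.
      have hAB := hA.trans (meetProb_mono h0.le h1 (Finset.subset_union_left (s₂ := B)))
      exact add_le_add (mul_le_mul_of_nonneg_left hAB (by linarith))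
        (mul_le_mul_of_nonneg_left (add_le_add hA hB) (by linarith))
    rw [density_succ, meetProb_succ]
    rcases le_total (density (consSection S false)) (density (consSection S true)) with h | h
    · exact key _ _ h
    · rw [add_comm (density _), Finset.union_comm, add_comm (meetProb β (consSection S true))]
      exact key _ _ h

/-! ### Forcing the first satisfied term -/

/-- The restriction `ρ` with the variables of `t` fixed so as to satisfy `t`. -/
def Term.override {n : ℕ} (t ρ : Term n) : Term n := fun i => (t i).or (ρ i)

theorem Term.eval_override {n : ℕ} {t ρ : Term n} {x : Fin n → Bool}
    (ht : Term.eval t x = true) (hρ : Term.eval ρ x = true) :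
    Term.eval (Term.override t ρ) x = true := by
  rw [Term.eval_iff] at *
  intro i b h
  cases hi : t i with
  | none => exact hρ i b (by simpa [Term.override, hi] using h)
  | some c => exact ht i b (by simpa [Term.override, hi] using h)

/-- `ρ` fixes every literal of `s` to true. -/
def Term.Contains {n : ℕ} (ρ s : Term n) : Prop := ∀ i b, s i = some b → ρ i = some b

theorem Term.Contains.eval {n : ℕ} {ρ s : Term n} (h : Term.Contains ρ s) {x : Fin n → Bool}
    (hx : Term.eval ρ x = true) : Term.eval s x = true := by
  rw [Term.eval_iff] at *
  exact fun i b hi => hx i b (h i b hi)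

theorem Term.contains_override {n : ℕ} (t ρ : Term n) :
    Term.Contains (Term.override t ρ) t := by
  intro i b h
  simp [Term.override, h]

/-- The restrictions compatible with `t` and mapped to the same restriction by `t.override` have
small total weight. -/
theorem sum_restrictionWeight_fiber_le {β : ℝ} (h0 : 0 < β) (h1 : β ≤ 1) {n : ℕ} (t σ : Term n)
    (hσ : Term.Contains σ t) (F : Finset (Term n))
    (hF : ∀ ρ ∈ F, Term.override t ρ = σ ∧ ∀ i b, t i = some b → ρ i = none ∨ ρ i = some b) :
    ∑ ρ ∈ F, restrictionWeight β ρ ≤ (2 / β) ^ Term.width t * restrictionWeight β σ := by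
  let c : Fin n → Finset (Option Bool) := fun i => if t i = none then {σ i} else {none, t i}
  have hsub : F ⊆ Fintype.piFinset c := by
    intro ρ hρ
    obtain ⟨rfl, h⟩ := hF ρ hρ
    rw [Fintype.mem_piFinset]
    intro i
    cases hi : t i with
    | none => simp [c, hi, Term.override]
    | some b => simpa [c, hi] using h i b hi
  refine (Finset.sum_le_sum_of_subset_of_nonneg hsub
    fun ρ _ _ => restrictionWeight_nonneg h0.le h1 ρ).trans ?_
  unfold restrictionWeight
  rw [← Finset.prod_univ_sum c (fun _ (o : Option Bool) => o.elim (1 - β) fun _ => β / 2),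
    Term.width, Finset.card_filter, ← Finset.prod_pow_eq_pow_sum, ← Finset.prod_mul_distrib]
  refine Finset.prod_le_prod (fun i _ => Finset.sum_nonneg fun o _ => ?_) fun i _ => ?_
  · cases o <;> simp <;> linarith
  · cases hi : t i with
    | none => simp [c, hi]
    | some b =>
      -- On a literal of `t` the fibre has weight `(1 - β) + β / 2 ≤ 1`, against `β / 2` in `σ`.
      have h2 : 2 / β * (β / 2) = 1 := by field_simp
      simp [c, hi, hσ i b hi, h2]
      linarith

/-- The inputs at which `T i` is the first satisfied term. -/
def firstHit {n m : ℕ} (T : Fin m → Term n) (i : Fin m) : Finset (Fin n → Bool) :=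
  Finset.univ.filter fun x => Term.eval (T i) x = true ∧ ∀ j < i, Term.eval (T j) x ≠ true

open Classical in
/-- The restrictions under which `T i` is the first term forced to be true. -/
noncomputable def firstForced {n m : ℕ} (T : Fin m → Term n) (i : Fin m) : Finset (Term n) :=
  Finset.univ.filter fun ρ => Term.Contains ρ (T i) ∧ ∀ j < i, ¬ Term.Contains ρ (T j)

/-- A point of the first-hit set in the subcube survives the override and falsifies all earlier
terms, so none of them is forced. -/
theorem meetProb_firstHit_le {β : ℝ} (h0 : 0 < β) (h1 : β ≤ 1) {n m : ℕ} (T : Fin m → Term n)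
    (i : Fin m) :
    meetProb β (firstHit T i) ≤
      (2 / β) ^ Term.width (T i) * ∑ σ ∈ firstForced T i, restrictionWeight β σ := by
  classical
  unfold meetProb
  rw [← Finset.sum_fiberwise_of_maps_to (t := firstForced T i) (g := Term.override (T i)),
    Finset.mul_sum]
  · refine Finset.sum_le_sum fun σ hσ => ?_
    simp only [firstForced, Finset.mem_filter, Finset.mem_univ, true_and] at hσ
    refine sum_restrictionWeight_fiber_le h0 h1 (T i) σ hσ.1 _ fun ρ hρ => ?_
    simp only [firstHit, Finset.mem_filter, Finset.mem_univ, true_and] at hρ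
    obtain ⟨⟨x, ⟨hx, -⟩, hxρ⟩, h⟩ := hρ
    refine ⟨h, fun k b hk => ?_⟩
    rw [Term.eval_iff] at hx hxρ
    cases hρk : ρ k with
    | none => exact Or.inl rfl
    | some c => rw [← hx k b hk, ← hxρ k c hρk]; exact Or.inr rfl
  · intro ρ hρ
    simp only [firstHit, firstForced, Finset.mem_filter, Finset.mem_univ, true_and] at hρ ⊢
    obtain ⟨x, ⟨hx, hlt⟩, hxρ⟩ := hρ
    exact ⟨Term.contains_override _ _, fun j hj hc =>
      hlt j hj (hc.eval (Term.eval_override hx hxρ))⟩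

/-- A random restriction leaves few terms that can be the first satisfied one. -/
theorem sum_meetProb_firstHit_le {β : ℝ} (h0 : 0 < β) (h1 : β ≤ 1) {n m w : ℕ}
    (T : Fin m → Term n) (hT : ∀ i, Term.width (T i) ≤ w) :
    ∑ i, meetProb β (firstHit T i) ≤ (2 / β) ^ w := by
  classical
  have hβ : 1 ≤ 2 / β := by rw [le_div_iff₀ h0]; linarith
  calc ∑ i, meetProb β (firstHit T i)
      ≤ ∑ i, (2 / β) ^ w * ∑ σ ∈ firstForced T i, restrictionWeight β σ := by
        refine Finset.sum_le_sum fun i _ => (meetProb_firstHit_le h0 h1 T i).trans ?_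
        exact mul_le_mul_of_nonneg_right (pow_le_pow_right₀ hβ (hT i))
          (Finset.sum_nonneg fun σ _ => restrictionWeight_nonneg h0.le h1 σ)
    _ = (2 / β) ^ w * ∑ σ ∈ Finset.univ.biUnion (firstForced T), restrictionWeight β σ := by
        rw [← Finset.mul_sum, Finset.sum_biUnion]
        intro i _ j _ hij
        refine Finset.disjoint_left.2 fun σ hi hj => ?_
        simp only [firstForced, Finset.mem_filter, Finset.mem_univ, true_and] at hi hj
        rcases lt_or_gt_of_ne hij with h | h
        · exact hj.2 i h hi.1
        · exact hi.2 j h hj.1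
    _ ≤ (2 / β) ^ w * ∑ σ : Term n, restrictionWeight β σ :=
        mul_le_mul_of_nonneg_left (Finset.sum_le_sum_of_subset_of_nonneg (Finset.subset_univ _)
          fun σ _ _ => restrictionWeight_nonneg h0.le h1 σ) (by positivity)
    _ = (2 / β) ^ w := by rw [sum_restrictionWeight, mul_one]

/-! ### Pruning rare terms -/

/-- The terms of `f` that are the first satisfied one with probability at least `τ`. -/
noncomputable def DNF.prune {n : ℕ} (f : DNF n) (τ : ℝ) : DNF n :=
  (Finset.univ.filter fun i => τ ≤ density (firstHit f.get i)).toList.map f.get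

theorem DNF.mem_prune {n : ℕ} {f : DNF n} {τ : ℝ} {t : Term n} :
    t ∈ f.prune τ ↔ ∃ i, τ ≤ density (firstHit f.get i) ∧ f.get i = t := by
  simp [DNF.prune]

theorem DNF.eval_iff {n : ℕ} (f : DNF n) (x : Fin n → Bool) :
    f.eval x = true ↔ ∃ t ∈ f, Term.eval t x = true := by
  simp [DNF.eval]

theorem DNF.HasWidth.prune {n w : ℕ} {f : DNF n} (hf : f.HasWidth w) (τ : ℝ) :
    (f.prune τ).HasWidth w := by
  intro t ht
  obtain ⟨i, -, rfl⟩ := DNF.mem_prune.1 ht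
  exact hf _ (List.get_mem f i)

theorem DNF.size_prune_mul_rpow_le {β : ℝ} (h0 : 0 < β) (h1 : β ≤ 1) {n w : ℕ} {f : DNF n}
    (hf : f.HasWidth w) {τ : ℝ} (hτ : 0 ≤ τ) :
    ((f.prune τ).size : ℝ) * τ ^ β ≤ (2 / β) ^ w := by
  refine le_trans ?_ (sum_meetProb_firstHit_le h0 h1 f.get fun i => hf _ (List.get_mem f i))
  have hsize : (f.prune τ).size =
      (Finset.univ.filter fun i => τ ≤ density (firstHit f.get i)).card := by
    simp [DNF.size, DNF.prune]
  rw [hsize, ← nsmul_eq_mul]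
  refine (Finset.card_nsmul_le_sum _ (fun i => meetProb β (firstHit f.get i)) _ ?_).trans
    (Finset.sum_le_sum_of_subset_of_nonneg (Finset.subset_univ _)
      fun i _ _ => meetProb_nonneg h0.le h1 _)
  intro i hi
  exact (Real.rpow_le_rpow hτ (Finset.mem_filter.1 hi).2 h0.le).trans
    (density_rpow_le_meetProb h0 h1 _)

/-- The inputs where pruning changes the value are first hits of the removed terms. -/
theorem DNF.filter_prune_ne_subset {n : ℕ} (f : DNF n) (τ : ℝ) :
    (Finset.univ.filter fun x => ¬ (f.prune τ).eval x = f.eval x) ⊆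
      (Finset.univ.filter fun i => ¬ τ ≤ density (firstHit f.get i)).biUnion
        (firstHit f.get) := by
  intro x hx
  have hle : (f.prune τ).eval x = true → f.eval x = true := by
    simp only [DNF.eval_iff]
    rintro ⟨t, ht, hxt⟩
    obtain ⟨i, -, rfl⟩ := DNF.mem_prune.1 ht
    exact ⟨_, List.get_mem f i, hxt⟩
  have hne := (Finset.mem_filter.1 hx).2
  have hfx : f.eval x = true := by
    by_contra h
    exact hne (by rw [Bool.eq_false_of_not_eq_true h, Bool.eq_false_of_not_eq_true (mt hle h)])
  have hgx : ¬ (f.prune τ).eval x = true := fun h => hne (h.trans hfx.symm)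
  obtain ⟨t, ht, hxt⟩ := (DNF.eval_iff f x).1 hfx
  obtain ⟨k, rfl⟩ := List.get_of_mem ht
  obtain ⟨i, hi, hmin⟩ := WellFounded.has_min (wellFounded_lt (α := Fin f.length))
    {i | Term.eval (f.get i) x = true} ⟨k, hxt⟩
  have hmem : x ∈ firstHit f.get i := by
    simp only [firstHit, Finset.mem_filter, Finset.mem_univ, true_and]
    exact ⟨hi, fun j hj h => hmin j h hj⟩
  refine Finset.mem_biUnion.2 ⟨i, Finset.mem_filter.2 ⟨Finset.mem_univ _, fun hτ => hgx ?_⟩, hmem⟩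
  exact (DNF.eval_iff _ x).2 ⟨_, DNF.mem_prune.2 ⟨i, hτ, rfl⟩, hi⟩

/-- Splits `p = √p * √p`: one factor is below `δ`, the other at most `p ^ β`. -/
theorem le_mul_rpow_of_lt_sq {β p δ : ℝ} (hβ : β ≤ 1 / 2) (hp0 : 0 ≤ p) (hp1 : p ≤ 1)
    (hδ : 0 ≤ δ) (h : p < δ ^ 2) : p ≤ δ * p ^ β := by
  rcases hp0.eq_or_lt with rfl | hp
  · exact mul_nonneg hδ (Real.rpow_nonneg le_rfl _)
  · have h2 : √p ≤ p ^ β := by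
      rw [Real.sqrt_eq_rpow]
      exact Real.rpow_le_rpow_of_exponent_ge hp hp1 hβ
    calc p = √p * √p := (Real.mul_self_sqrt hp0).symm
      _ ≤ δ * p ^ β := mul_le_mul ((Real.sqrt_le_left hδ).2 h.le) h2 (Real.sqrt_nonneg _) hδ

theorem DNF.approximates_prune {β δ : ℝ} (h0 : 0 < β) (h1 : β ≤ 1 / 2) (hδ : 0 ≤ δ) {n w : ℕ}
    {f : DNF n} (hf : f.HasWidth w) :
    Approximates (δ * (2 / β) ^ w) (f.prune (δ ^ 2)).eval f.eval := by
  have hβ : β ≤ 1 := by linarith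
  have hcard := Finset.card_filter_add_card_filter_not (s := (Finset.univ : Finset (Fin n → Bool)))
    (fun x => (f.prune (δ ^ 2)).eval x = f.eval x)
  simp only [Finset.card_univ, Fintype.card_pi, Fintype.card_bool, Finset.prod_const,
    Fintype.card_fin] at hcard
  have hbad : (((Finset.univ.filter fun x =>
      ¬ (f.prune (δ ^ 2)).eval x = f.eval x).card : ℕ) : ℝ) / 2 ^ n ≤ δ * (2 / β) ^ w := by
    calc _ ≤ ((∑ i ∈ Finset.univ.filter (fun i => ¬ δ ^ 2 ≤ density (firstHit f.get i)),
              (firstHit f.get i).card : ℕ) : ℝ) / 2 ^ n := by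
          gcongr
          exact (Finset.card_le_card (f.filter_prune_ne_subset _)).trans Finset.card_biUnion_le
      _ = ∑ i ∈ Finset.univ.filter (fun i => ¬ δ ^ 2 ≤ density (firstHit f.get i)),
            density (firstHit f.get i) := by
          simp only [density, Nat.cast_sum, Finset.sum_div]
      _ ≤ ∑ i ∈ Finset.univ.filter (fun i => ¬ δ ^ 2 ≤ density (firstHit f.get i)),
            δ * meetProb β (firstHit f.get i) := by
          refine Finset.sum_le_sum fun i hi => ?_
          refine (le_mul_rpow_of_lt_sq h1 (density_nonneg _) (density_le_one _) hδ
            (not_le.1 (Finset.mem_filter.1 hi).2)).trans ?_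
          exact mul_le_mul_of_nonneg_left (density_rpow_le_meetProb h0 hβ _) hδ
      _ ≤ ∑ i, δ * meetProb β (firstHit f.get i) :=
          Finset.sum_le_sum_of_subset_of_nonneg (Finset.subset_univ _)
            fun i _ _ => mul_nonneg hδ (meetProb_nonneg h0.le hβ _)
      _ ≤ δ * (2 / β) ^ w := by
          rw [← Finset.mul_sum]
          exact mul_le_mul_of_nonneg_left
            (sum_meetProb_firstHit_le h0 hβ f.get fun i => hf _ (List.get_mem f i)) hδ
  have hcard' : ((Finset.univ.filter fun x =>
      (f.prune (δ ^ 2)).eval x = f.eval x).card : ℝ) + ((Finset.univ.filter fun x =>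
      ¬ (f.prune (δ ^ 2)).eval x = f.eval x).card : ℝ) = 2 ^ n := by exact_mod_cast hcard
  unfold Approximates
  rw [eq_sub_of_add_eq hcard', sub_div, div_self (by positivity)]
  linarith

/-! ### Choice of parameters -/

/-- The size bound for `DNF.prune` at the threshold `(ε / K) ^ 2` with `K = (2 / β) ^ w`. -/
theorem le_pow_of_mul_rpow_le {w : ℕ} (hw : 1 ≤ w) {ε β B s : ℝ} (hε : 0 < ε) (hε1 : ε < 1)
    (hB : B = 2 + 1 / (w : ℝ) * Real.logb 2 (1 / ε)) (hβ : β = 1 / B)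
    (hs : s * ((ε / (2 / β) ^ w) ^ 2) ^ β ≤ (2 / β) ^ w) : s ≤ B ^ (6 * w) := by
  have hw' : (0 : ℝ) < w := by exact_mod_cast hw
  set L := Real.logb 2 (1 / ε) with hL
  have hL0 : 0 < L := Real.logb_pos (by norm_num) (by rw [lt_div_iff₀ hε]; linarith)
  have hB2 : 2 ≤ B := by rw [hB]; have : 0 < 1 / (w : ℝ) * L := by positivity
                         linarith
  have hβ0 : 0 < β := by rw [hβ]; positivity
  have hβ1 : 2 * β ≤ 1 := by rw [hβ, mul_one_div, div_le_one (by linarith)]; exact hB2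
  have h2β : 2 / β = 2 * B := by rw [hβ]; field_simp
  set K : ℝ := (2 / β) ^ w with hK
  have hK1 : 1 ≤ K := one_le_pow₀ (by rw [h2β]; linarith)
  have hK0 : 0 < K := by linarith
  have hKB : K ≤ B ^ (2 * w) := by
    rw [hK, h2β, pow_mul]
    exact pow_le_pow_left₀ (by linarith) (by nlinarith) w
  have hεL : 1 / ε = 2 ^ L := (Real.rpow_logb (by norm_num) (by norm_num) (by positivity)).symm
  -- As `L = w * (B - 2)` and `β = 1 / B`, the power `(1 / ε) ^ (2 * β)` costs at most `2 ^ (2 *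
  -- w)`.
  have hLβ : L * (2 * β) ≤ (2 * w : ℕ) := by
    have hLw : L = w * (B - 2) := by rw [hB]; field_simp; ring
    have hBβ : B * β = 1 := by rw [hβ]; field_simp
    push_cast
    rw [hLw]
    nlinarith
  have hτ : (((ε / K) ^ 2) ^ β)⁻¹ ≤ B ^ (4 * w) := by
    have h : (((ε / K) ^ 2) ^ β)⁻¹ = K ^ (2 * β) * (1 / ε) ^ (2 * β) := by
      rw [← Real.rpow_natCast (ε / K) 2, ← Real.rpow_mul (by positivity),
        ← Real.inv_rpow (by positivity), ← Real.mul_rpow hK0.le (by positivity)]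
      congr 1
      field_simp
    rw [h, show 4 * w = 2 * w + 2 * w by ring, pow_add]
    refine mul_le_mul ?_ ?_ (by positivity) (by positivity)
    · exact (Real.rpow_le_rpow_of_exponent_le hK1 hβ1).trans (by rwa [Real.rpow_one])
    · rw [hεL, ← Real.rpow_mul (by norm_num)]
      refine (Real.rpow_le_rpow_of_exponent_le (by norm_num) hLβ).trans ?_
      rw [Real.rpow_natCast]
      exact pow_le_pow_left₀ (by norm_num) hB2 _
  have hpos : 0 < ((ε / K) ^ 2) ^ β := by positivity
  calc s ≤ K * (((ε / K) ^ 2) ^ β)⁻¹ := by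
        rw [← div_eq_mul_inv, le_div_iff₀ hpos]; exact hs
    _ ≤ B ^ (2 * w) * B ^ (4 * w) := mul_le_mul hKB hτ (by positivity) (by positivity)
    _ = B ^ (6 * w) := by rw [← pow_add]; congr 1; ring

/-- Every width-`w` DNF is `ε`-approximated by a width-`w` DNF of size `(2 + log (1/ε) / w) ^ 6w`. -/
theorem DNF.exists_approximates {n w : ℕ} (hw : 1 ≤ w) {ε : ℝ} (hε : 0 < ε) {f : DNF n}
    (hf : f.HasWidth w) :
    ∃ g : DNF n, g.HasWidth w ∧
      (g.size : ℝ) ≤ (2 + 1 / (w : ℝ) * Real.logb 2 (1 / ε)) ^ (6 * w) ∧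
      Approximates ε g.eval f.eval := by
  rcases le_or_gt 1 ε with hε1 | hε1
  · refine ⟨[], by simp [DNF.HasWidth], ?_, ?_⟩
    · simp only [DNF.size, List.length_nil, Nat.cast_zero]
      -- For large `ε` the base may be negative; the even exponent saves the bound.
      exact Even.pow_nonneg (Even.mul_right (by decide) w) _
    · have : (0 : ℝ) ≤ ((Finset.univ.filter fun x =>
        DNF.eval ([] : DNF n) x = f.eval x).card : ℝ) / 2 ^ n := by positivity
      unfold Approximates
      linarith
  · set B := 2 + 1 / (w : ℝ) * Real.logb 2 (1 / ε) with hB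
    have hL0 : 0 < Real.logb 2 (1 / ε) :=
      Real.logb_pos (by norm_num) (by rw [lt_div_iff₀ hε]; linarith)
    have hB2 : 2 ≤ B := by
      have : 0 ≤ 1 / (w : ℝ) * Real.logb 2 (1 / ε) := by positivity
      linarith
    have hβ0 : 0 < 1 / B := by positivity
    have hβ1 : 1 / B ≤ 1 / 2 := one_div_le_one_div_of_le (by norm_num) hB2
    have hK : 0 < (2 / (1 / B)) ^ w := by positivity
    refine ⟨f.prune ((ε / (2 / (1 / B)) ^ w) ^ 2), hf.prune _, ?_, ?_⟩
    · exact le_pow_of_mul_rpow_le hw hε hε1 hB rfl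
        (DNF.size_prune_mul_rpow_le hβ0 (by linarith) hf (by positivity))
    · have := DNF.approximates_prune hβ0 hβ1 (δ := ε / (2 / (1 / B)) ^ w) (by positivity) hf
      rwa [div_mul_cancel₀ _ hK.ne'] at this

theorem exists_two_add_le_pow {ε₀ : ℝ} (hε₀ : ε₀ < 1 / 2) :
    ∃ k : ℕ, ∀ (w : ℕ), 1 ≤ w → ∀ ε : ℝ, 0 < ε → ε ≤ ε₀ →
      0 ≤ 2 + 1 / (w : ℝ) * Real.logb 2 (1 / ε) ∧
      2 + 1 / (w : ℝ) * Real.logb 2 (1 / ε) ≤ Real.logb 2 (1 / ε) ^ k := by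
  rcases le_or_gt ε₀ 0 with h | h
  · exact ⟨0, fun w _ ε h0 h1 => absurd (h0.trans_le h1) (not_lt.2 h)⟩
  have hL₀ : 1 < Real.logb 2 (1 / ε₀) := by
    rw [Real.lt_logb_iff_rpow_lt (by norm_num) (by positivity), Real.rpow_one, lt_div_iff₀ h]
    linarith
  -- The 3 comes from `2 + L / w ≤ 3 * L ≤ L ^ (k + 1)`, valid for `L > 1`.
  obtain ⟨k, hk⟩ := pow_unbounded_of_one_lt 3 hL₀
  refine ⟨k + 1, fun w hw ε h0 h1 => ?_⟩
  have hL : Real.logb 2 (1 / ε₀) ≤ Real.logb 2 (1 / ε) :=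
    Real.logb_le_logb_of_le (by norm_num) (by positivity) (one_div_le_one_div_of_le h0 h1)
  set L := Real.logb 2 (1 / ε)
  have hL1 : 1 < L := hL₀.trans_le hL
  have hw1 : 1 / (w : ℝ) ≤ 1 := by
    rw [div_le_one (by positivity)]; exact_mod_cast hw
  have hkL : 3 ≤ L ^ k := hk.le.trans (pow_le_pow_left₀ (by linarith) hL k)
  refine ⟨by positivity, ?_⟩
  rw [pow_succ]
  nlinarith

end BoolFun

theorem mainTheorem4 :
    -- the size bound `(2 + (1/w) log (1/ε)) ^ O(w)`
    (∃ C : ℕ, ∀ (n w : ℕ), 1 ≤ w → ∀ ε : ℝ, 0 < ε →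
      ∀ f : BoolFun.DNF n, BoolFun.DNF.HasWidth f w →
        ∃ g : BoolFun.DNF n, BoolFun.DNF.HasWidth g w ∧
          (BoolFun.DNF.size g : ℝ) ≤ (2 + 1 / (w : ℝ) * Real.logb 2 (1 / ε)) ^ (C * w) ∧
          BoolFun.Approximates ε (BoolFun.DNF.eval g) (BoolFun.DNF.eval f)) ∧
    -- the conjectured size bound `(log (1/ε)) ^ O(w)`, for `ε` bounded away from `1/2`
    (∀ ε₀ : ℝ, ε₀ < 1 / 2 → ∃ C : ℕ, ∀ (n w : ℕ), 1 ≤ w → ∀ ε : ℝ, 0 < ε → ε ≤ ε₀ →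
      ∀ f : BoolFun.DNF n, BoolFun.DNF.HasWidth f w →
        ∃ g : BoolFun.DNF n, BoolFun.DNF.HasWidth g w ∧
          (BoolFun.DNF.size g : ℝ) ≤ (Real.logb 2 (1 / ε)) ^ (C * w) ∧
          BoolFun.Approximates ε (BoolFun.DNF.eval g) (BoolFun.DNF.eval f)) := by
  refine ⟨⟨6, fun n w hw ε hε f hf => BoolFun.DNF.exists_approximates hw hε hf⟩,
    fun ε₀ hε₀ => ?_⟩
  obtain ⟨k, hk⟩ := BoolFun.exists_two_add_le_pow hε₀
  refine ⟨k * 6, fun n w hw ε hε hεε₀ f hf => ?_⟩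
  obtain ⟨g, hg, hsize, happ⟩ := BoolFun.DNF.exists_approximates hw hε hf
  obtain ⟨hB0, hB⟩ := hk w hw ε hε hεε₀
  refine ⟨g, hg, hsize.trans ?_, happ⟩
  rw [mul_assoc, pow_mul _ k]
  exact pow_le_pow_left₀ hB0 hB _
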